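/- Let $\Phi$ be a homogeneous Poisson point process of intensity $\lambda>0$ in the plane $\mathbb{R}^2$. For a locally finite set $\varphi\subset\mathbb{R}^2$ and distinct $x,y\in\varphi$ write $x\overset{\varphi}{\rightarrow}y$ if $y$ is the unique minimiser of $z\mapsto|x-z|$ over $z\in\varphi\setminus\{x\}$. Two atoms $x,y\in\varphi$ are in mutual nearest neighbour relation, $x\overset{\varphi}{\leftrightarrow}y$, if $x\overset{\varphi}{\rightarrow}y$ and $y\overset{\varphi}{\rightarrow}x$; an atom $x\in\varphi$ is single if it is in this relation with no other atom of $\varphi$. Let $\mathbb{P}^{0}$ be the Palm distribution of $\Phi$, that is, the probability measure on the space of locally finite configurations such that \[ \mathbb{E}\sum_{x\in\Phi}\mathbf 1\{x\in A\}\,\mathbf 1\{\Phi-x\in\Gamma\}=\lambda\,|A|\,\mathbb{P}^{0}(\Gamma) \] for every Borel set $A\subseteq\mathbb{R}^2$ of area $|A|$ and every event $\Gamma$, and for $x\in\mathbb{R}^2$ let $\mathbb{P}^{x}$ be the image of $\mathbb{P}^{0}$ under the translation $\varphi\mapsto\varphi+x$. Then $\mathbb{P}^{0}$ exists and is unique,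 and there is a constant $p^*$, independent of $\lambda$ and $x$, such that for every $\lambda>0$ and every $x\in\mathbb{R}^2$ \[ \mathbb{P}^{x}\bigl(\{\varphi : x\overset{\varphi}{\leftrightarrow}y\text{ for some }y\in\varphi\}\bigr)=p^*, \qquad \mathbb{P}^{x}\bigl(\{\varphi : x\in\varphi\text{ is single in }\varphi\}\bigr)=1-p^*. \] Specifically, $p^*=\dfrac{1}{2-\gamma}$ with $\gamma=\dfrac23-\dfrac{\sqrt3}{2\pi}$, and $p^*\approx 0.6215$ (to four decimal places). -/

import Mathlib

open MeasureTheory ProbabilityTheory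
open scoped NNReal ENNReal

namespace PlanarPP

/-- The Euclidean plane. -/
abbrev Plane : Type := EuclideanSpace ℝ (Fin 2)

/-- A realisation of a simple planar point process: a set of atoms with finitely many atoms in
every bounded set. -/
@[ext]
structure Config where
  /-- The set of atoms. -/
  atoms : Set Plane
  /-- Every bounded set contains only finitely many atoms. -/
  finite_inter : ∀ B : Set Plane, Bornology.IsBounded B → (atoms ∩ B).Finite

/-- The number of atoms in `B` (used for bounded `B` only, where it is finite). -/
noncomputable def count (B : Set Plane) (φ : Config) : ℕ := (φ.atoms ∩ B).ncard

/-- The usual σ-algebra on configurations, generated by the numbers of atoms in the bounded Borel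
sets. -/
noncomputable instance : MeasurableSpace Config :=
  ⨆ (B : Set Plane) (_ : Bornology.IsBounded B) (_ : MeasurableSet B),
    MeasurableSpace.comap (count B) ⊤

/-- The translate `φ + x` of a configuration. -/
def translate (x : Plane) (φ : Config) : Config where
  atoms := (fun z => z + x) '' φ.atoms
  finite_inter := by
    intro B hB
    have hB' : Bornology.IsBounded ((fun z : Plane => z + -x) '' B) := by
      obtain ⟨r, hr⟩ := hB.exists_norm_le
      refine isBounded_iff_forall_norm_le.2 ⟨r + ‖x‖, ?_⟩
      rintro _ ⟨z, hz, rfl⟩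
      calc ‖z + -x‖ ≤ ‖z‖ + ‖-x‖ := norm_add_le _ _
        _ ≤ r + ‖x‖ := by rw [norm_neg]; gcongr; exact hr z hz
    refine ((φ.finite_inter _ hB').image (fun z => z + x)).subset ?_
    rintro _ ⟨⟨z, hz, rfl⟩, hzB⟩
    exact ⟨z, ⟨hz, ⟨z + x, hzB, by simp⟩⟩, rfl⟩

theorem count_translate (x : Plane) (B : Set Plane) (φ : Config) :
    count B (translate x φ) = count ((fun z => z + x) ⁻¹' B) φ := by
  have h : (translate x φ).atoms ∩ B =
      (fun z => z + x) '' (φ.atoms ∩ (fun z => z + x) ⁻¹' B) := by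
    rw [Set.image_inter_preimage]; rfl
  unfold count
  rw [h, Set.ncard_image_of_injective _ (add_left_injective x)]

theorem measurable_count {B : Set Plane} (hB : Bornology.IsBounded B) (hBm : MeasurableSet B) :
    Measurable (count B) := by
  apply Measurable.of_comap_le
  exact le_iSup_of_le B (le_iSup_of_le hB (le_iSup_of_le hBm le_rfl))

/-- Translation is measurable, so that image measures under it are meaningful. -/
theorem measurable_translate (x : Plane) : Measurable (translate x) := by
  refine Measurable.of_le_map (iSup_le fun B => iSup_le fun hB => iSup_le fun hBm => ?_)
  rw [MeasurableSpace.comap_le_iff_le_map, MeasurableSpace.map_comp]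
  have hB' : Bornology.IsBounded ((fun z : Plane => z + x) ⁻¹' B) := by
    obtain ⟨r, hr⟩ := hB.exists_norm_le
    refine isBounded_iff_forall_norm_le.2 ⟨r + ‖x‖, fun z hz => ?_⟩
    calc ‖z‖ = ‖(z + x) - x‖ := by simp
      _ ≤ ‖z + x‖ + ‖x‖ := norm_sub_le _ _
      _ ≤ r + ‖x‖ := by gcongr; exact hr _ hz
  have h : count B ∘ translate x = count ((fun z => z + x) ⁻¹' B) :=
    funext fun φ => count_translate x B φ
  rw [h]
  exact (measurable_count hB' (measurable_id.add_const x hBm)).le_map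

/-- Nearest Neighbour Relation: `y` is the (unique) minimiser of the distance to `x` among the
atoms of `φ` other than `x`. -/
def NNR (φ : Config) (x y : Plane) : Prop :=
  y ∈ φ.atoms \ {x} ∧ ∀ z ∈ φ.atoms \ {x}, z ≠ y → dist x y < dist x z

/-- Mutually Nearest Neighbour Relation between two atoms of `φ`. -/
def MNNR (φ : Config) (x y : Plane) : Prop := NNR φ x y ∧ NNR φ y x

/-- The atom `x` of `φ` is single: it is not in MNNR with any other atom. -/
def IsSingle (φ : Config) (x : Plane) : Prop :=
  x ∈ φ.atoms ∧ ∀ y ∈ φ.atoms \ {x}, NNR φ x y → ¬ NNR φ y x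

/-- `Φ` is a homogeneous Poisson point process of intensity `lam` in the plane: the number of atoms
in a bounded Borel set `B` is Poisson with mean `lam` times the area of `B`, and the numbers of
atoms in finitely many pairwise disjoint bounded Borel sets are independent. -/
structure IsPoissonProcess {Ω : Type*} [MeasurableSpace Ω] (P : Measure Ω) (lam : ℝ≥0)
    (Φ : Ω → Config) : Prop where
  measurable : Measurable Φ
  hasLaw_count : ∀ B : Set Plane, Bornology.IsBounded B → MeasurableSet B →
    HasLaw (fun ω => count B (Φ ω)) (poissonMeasure (lam * (volume B).toNNReal)) P
  indep_count : ∀ (n : ℕ) (B : Fin n → Set Plane),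
    (∀ i, Bornology.IsBounded (B i)) → (∀ i, MeasurableSet (B i)) →
    (∀ i j, i ≠ j → Disjoint (B i) (B j)) →
    iIndepFun (fun i ω => count (B i) (Φ ω)) P

/-- `P₀` is the Palm distribution (at the origin) of the stationary point process `Φ` of intensity
`lam`: a probability measure such that, for all Borel sets `A` and events `Γ`,
`E ∑_{x ∈ Φ} 1{x ∈ A} 1{Φ - x ∈ Γ} = lam * area(A) * P₀(Γ)`. -/
structure IsPalm {Ω : Type*} [MeasurableSpace Ω] (P : Measure Ω) (lam : ℝ≥0)
    (Φ : Ω → Config) (P₀ : Measure Config) : Prop where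
  isProbabilityMeasure : IsProbabilityMeasure P₀
  campbell : ∀ (A : Set Plane) (Γ : Set Config), MeasurableSet A → MeasurableSet Γ →
    ∫⁻ ω, ∑' x : (Φ ω).atoms,
      A.indicator (fun _ => (1 : ℝ≥0∞)) (x : Plane) *
        Γ.indicator (fun _ => (1 : ℝ≥0∞)) (translate (-(x : Plane)) (Φ ω)) ∂P
      = lam * volume A * P₀ Γ

/-- The Palm distribution at the location `x`: the Palm distribution at the origin, translated
by `x`. -/
noncomputable def palmAt (P₀ : Measure Config) (x : Plane) : Measure Config :=
  P₀.map (translate x)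

/-- `γ = 2/3 - √3/(2π)`. -/
noncomputable def nnGamma : ℝ := 2 / 3 - √3 / (2 * Real.pi)

end PlanarPP

namespace PlanarPP

/-! ### Configurations and void events -/

/-! By the Slivnyak theorem the Palm distribution at `x` is the law of the Poisson process with an
atom added at `x`. Then `y` is the mutual nearest neighbour of `x` exactly when `y` is an atom and
no other atom lies in the union of the two closed discs of radius `|x - y|` centred at `x` and `y`.
At most one `y` qualifies, so the probability of having a partner equals the expected number of
partners. The Mecke equation turns this expectation into `λ ∫ exp(-λ |nnRegion x y|) dy`. The lens
common to the two discs has area `πγ|x - y|²`, so their union has area `π(2 - γ)|x - y|²`; the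
planar Gaussian integral gives `λ · π / (λπ(2 - γ)) = 1/(2 - γ)`.

The Mecke equation (`bind_atomMeasure`) carries the argument: summing over the atoms, each paired
with the configuration of the others, gives in mean the product of `λ` times area and the law of the
process. It suffices to check this on rectangles `A × voidEvent B`, since void events form a
π-system generating the σ-algebra (`generateFrom_boundedVoidEvents`). On such a rectangle only the
cases of zero atoms or one atom in `B` contribute, and both follow from independence over disjoint
sets. The Slivnyak theorem (`isPalm_map_insert`) follows by translation invariance. -/

theorem Config.countable_atoms (φ : Config) : φ.atoms.Countable := by
  have h : φ.atoms = ⋃ n : ℕ, φ.atoms ∩ Metric.closedBall 0 n := by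
    rw [← Set.inter_iUnion, Metric.iUnion_closedBall_nat, Set.inter_univ]
  rw [h]
  exact Set.countable_iUnion fun n => (φ.finite_inter _ Metric.isBounded_closedBall).countable

instance (φ : Config) : Countable φ.atoms := φ.countable_atoms.to_subtype

/-- The configuration `φ` with an atom added at `x`. -/
def Config.insert (x : Plane) (φ : Config) : Config where
  atoms := Insert.insert x φ.atoms
  finite_inter := by
    intro B hB
    refine ((φ.finite_inter B hB).insert x).subset ?_
    rintro z ⟨hz, hzB⟩
    rcases hz with rfl | hz
    · exact Or.inl rfl
    · exact Or.inr ⟨hz, hzB⟩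

/-- The configuration `φ` with the atom at `x` removed. -/
def Config.erase (x : Plane) (φ : Config) : Config where
  atoms := φ.atoms \ {x}
  finite_inter := fun B hB => (φ.finite_inter B hB).subset
    (Set.inter_subset_inter_left _ Set.sdiff_subset)

theorem Config.insert_erase {x : Plane} {φ : Config} (hx : x ∈ φ.atoms) :
    (φ.erase x).insert x = φ := by
  ext1
  simp only [Config.insert, Config.erase]
  rw [Set.insert_sdiff_singleton, Set.insert_eq_of_mem hx]

theorem translate_insert (x y : Plane) (φ : Config) :
    translate x (φ.insert y) = (translate x φ).insert (y + x) := by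
  ext1
  simp only [Config.insert, translate]
  rw [Set.image_insert_eq]

/-- The event that there is no atom in `B`. -/
def voidEvent (B : Set Plane) : Set Config := {φ | φ.atoms ∩ B = ∅}

theorem count_eq_zero_iff {B : Set Plane} (hB : Bornology.IsBounded B) (φ : Config) :
    count B φ = 0 ↔ φ.atoms ∩ B = ∅ := by
  rw [count, Set.ncard_eq_zero (φ.finite_inter B hB)]

theorem voidEvent_eq_preimage {B : Set Plane} (hB : Bornology.IsBounded B) :
    voidEvent B = count B ⁻¹' {0} := by
  ext φ
  simp [voidEvent, count_eq_zero_iff hB]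

theorem measurableSet_voidEvent {B : Set Plane} (hB : Bornology.IsBounded B)
    (hBm : MeasurableSet B) : MeasurableSet (voidEvent B) := by
  rw [voidEvent_eq_preimage hB]
  exact measurable_count hB hBm (measurableSet_singleton 0)

/-- The void events of the bounded Borel sets. -/
def boundedVoidEvents : Set (Set Config) :=
  {V | ∃ B : Set Plane, Bornology.IsBounded B ∧ MeasurableSet B ∧ V = voidEvent B}

theorem isPiSystem_boundedVoidEvents : IsPiSystem boundedVoidEvents := by
  rintro _ ⟨B, hB, hBm, rfl⟩ _ ⟨C, hC, hCm, rfl⟩ -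
  refine ⟨B ∪ C, hB.union hC, hBm.union hCm, ?_⟩
  ext φ
  simp only [voidEvent, Set.mem_inter_iff, Set.mem_ofPred_eq, Set.inter_union_distrib_left,
    Set.union_empty_iff]

theorem univ_mem_boundedVoidEvents : Set.univ ∈ boundedVoidEvents :=
  ⟨∅, Bornology.isBounded_empty, MeasurableSet.empty, by ext; simp [voidEvent]⟩

/-- Finitely many atoms can be separated by disjoint sets from a countable basis. The existential
therefore ranges over a countable set, which expresses counts through countably many void events. -/
theorem le_count_iff {B : Set Plane} (hB : Bornology.IsBounded B) (φ : Config) (k : ℕ) :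
    k ≤ count B φ ↔ ∃ U : Fin k → TopologicalSpace.countableBasis Plane,
      Pairwise (fun i j => Disjoint (U i : Set Plane) (U j)) ∧
        ∀ i, (φ.atoms ∩ (B ∩ (U i : Set Plane))).Nonempty := by
  have hfin := φ.finite_inter B hB
  constructor
  · intro hk
    obtain ⟨t, ht, htk⟩ := Set.exists_subset_card_eq hk
    have htf : t.Finite := hfin.subset ht
    obtain ⟨V, hV, hVd⟩ := htf.t2_separation
    have hex : ∀ z : Plane, ∃ u ∈ TopologicalSpace.countableBasis Plane, z ∈ u ∧ u ⊆ V z :=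
      fun z => (TopologicalSpace.isBasis_countableBasis Plane).exists_subset_of_mem_open
        (hV z).1 (hV z).2
    choose u hu hzu huV using hex
    have : Finite t := htf
    have e : Fin k ≃ t := (Finite.equivFinOfCardEq (by rw [← htk]; rfl)).symm
    refine ⟨fun i => ⟨u (e i), hu _⟩, ?_, fun i => ⟨e i, (ht (e i).2).1, (ht (e i).2).2, hzu _⟩⟩
    intro i j hij
    exact (hVd (e i).2 (e j).2 (fun h => hij (e.injective (Subtype.ext h)))).mono
      (huV _) (huV _)
  · rintro ⟨U, hU, hne⟩
    choose z hz using hne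
    have hinj : Function.Injective z := by
      intro i j hij
      by_contra hne
      exact Set.disjoint_left.1 (hU hne) (hz i).2.2 (hij ▸ (hz j).2.2)
    have h1 : (Set.range z).ncard = k := by
      rw [← Set.image_univ, Set.ncard_image_of_injective _ hinj, Set.ncard_univ]
      simp
    rw [← h1]
    refine Set.ncard_le_ncard ?_ hfin
    rintro _ ⟨i, rfl⟩
    exact ⟨(hz i).1, (hz i).2.1⟩

/-- Together with the π-system property, this means that void probabilities determine the law of a
configuration, and that measurability into `Config` need only be tested on void events. -/
theorem generateFrom_boundedVoidEvents :
    instMeasurableSpaceConfig =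
      MeasurableSpace.generateFrom boundedVoidEvents := by
  apply le_antisymm
  · refine iSup_le fun B => iSup_le fun hB => iSup_le fun hBm => ?_
    rw [← measurable_iff_comap_le]
    refine measurable_of_Ici (mδ := .generateFrom boundedVoidEvents) fun k => ?_
    have : count B ⁻¹' Set.Ici k =
        ⋃ U : {U : Fin k → TopologicalSpace.countableBasis Plane //
          Pairwise (fun i j => Disjoint (U i : Set Plane) (U j))},
        ⋂ i : Fin k, (voidEvent (B ∩ (U.1 i : Set Plane)))ᶜ := by
      ext φ
      simp only [Set.mem_preimage, Set.mem_Ici, le_count_iff hB, Set.mem_iUnion, Set.mem_iInter,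
        Set.mem_compl_iff, voidEvent, Set.mem_ofPred_eq, Subtype.exists, exists_prop,
        Set.nonempty_iff_ne_empty, ne_eq]
    rw [this]
    have : Countable (TopologicalSpace.countableBasis Plane) :=
      (TopologicalSpace.countable_countableBasis Plane).to_subtype
    refine MeasurableSet.iUnion fun U => MeasurableSet.iInter fun i => MeasurableSet.compl ?_
    exact MeasurableSpace.measurableSet_generateFrom
      ⟨_, hB.subset Set.inter_subset_left,
        hBm.inter (TopologicalSpace.isOpen_of_mem_countableBasis (U.1 i).2).measurableSet, rfl⟩
  · refine MeasurableSpace.generateFrom_le ?_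
    rintro _ ⟨B, hB, hBm, rfl⟩
    exact measurableSet_voidEvent hB hBm

theorem measurable_of_voidEvent {α : Type*} [MeasurableSpace α] {f : α → Config}
    (hf : ∀ B : Set Plane, Bornology.IsBounded B → MeasurableSet B →
      MeasurableSet {a | (f a).atoms ∩ B = ∅}) : Measurable f := by
  rw [generateFrom_boundedVoidEvents]
  refine measurable_generateFrom ?_
  rintro _ ⟨B, hB, hBm, rfl⟩
  exact hf B hB hBm

/-! ### The measures of atoms, and of atoms with the remaining configuration -/

/-- The sum of the unit masses at the pairs of an atom and the configuration of the other atoms. -/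
noncomputable def atomMeasure (φ : Config) : Measure (Plane × Config) :=
  Measure.sum fun x : φ.atoms => Measure.dirac ((x : Plane), φ.erase x)

theorem atomMeasure_apply (φ : Config) {s : Set (Plane × Config)} (hs : MeasurableSet s) :
    atomMeasure φ s = ({x ∈ φ.atoms | (x, φ.erase x) ∈ s}.encard : ℝ≥0∞) := by
  rw [atomMeasure, Measure.sum_apply _ hs]
  simp_rw [Measure.dirac_apply' _ hs]
  rw [← ENNReal.tsum_set_one, tsum_subtype _ fun _ => (1 : ℝ≥0∞),
    tsum_subtype φ.atoms fun x => s.indicator (1 : Plane × Config → ℝ≥0∞) (x, φ.erase x)]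
  congr 1
  ext x
  by_cases h1 : x ∈ φ.atoms <;> by_cases h2 : (x, φ.erase x) ∈ s <;> simp [h1, h2]

theorem atomMeasure_prod (φ : Config) {s : Set Plane} (hs : MeasurableSet s) :
    atomMeasure φ (s ×ˢ Set.univ) = ((φ.atoms ∩ s).encard : ℝ≥0∞) := by
  rw [atomMeasure_apply φ (hs.prod MeasurableSet.univ)]
  congr 2
  ext x
  simp

theorem encard_eq_count {B : Set Plane} (hB : Bornology.IsBounded B) (φ : Config) :
    ((φ.atoms ∩ B).encard : ℝ≥0∞) = count B φ := by
  rw [count, ← (φ.finite_inter B hB).cast_ncard_eq]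
  rfl

/-- Erasing one atom can empty `B` only if `B` holds at most one. If it holds none, every atom of
`A` counts; if it holds exactly one, that atom must be the erased one, hence it must lie in `A ∩ B`.
-/
theorem atomMeasure_prod_voidEvent (φ : Config) {A B : Set Plane} (hA : Bornology.IsBounded A)
    (hAm : MeasurableSet A) (hB : Bornology.IsBounded B) (hBm : MeasurableSet B) :
    atomMeasure φ (A ×ˢ voidEvent B) =
      if count B φ = 0 then (count A φ : ℝ≥0∞)
      else if count B φ = 1 then (count (A ∩ B) φ : ℝ≥0∞) else 0 := by
  rw [atomMeasure_apply φ (hAm.prod (measurableSet_voidEvent hB hBm))]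
  split_ifs with h0 h1
  · rw [count_eq_zero_iff hB] at h0
    rw [← encard_eq_count hA]
    congr 2
    ext x
    simp only [Set.mem_ofPred_eq, Set.mem_prod, voidEvent, Config.erase, Set.mem_inter_iff]
    refine ⟨fun h => ⟨h.1, h.2.1⟩, fun h => ⟨h.1, h.2, ?_⟩⟩
    exact Set.subset_empty_iff.1 (h0 ▸ Set.inter_subset_inter_left _ Set.sdiff_subset)
  · rw [count, Set.ncard_eq_one] at h1
    obtain ⟨b, hb⟩ := h1
    rw [← encard_eq_count (hA.subset Set.inter_subset_left)]
    congr 2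
    ext x
    simp only [Set.mem_ofPred_eq, Set.mem_prod, voidEvent, Config.erase, Set.mem_inter_iff]
    have hbm : b ∈ φ.atoms ∩ B := hb ▸ rfl
    constructor
    · rintro ⟨hx, hxA, he⟩
      refine ⟨hx, hxA, ?_⟩
      by_contra hxB
      have : b ∈ φ.atoms \ {x} ∩ B := ⟨⟨hbm.1, fun h => hxB (h ▸ hbm.2)⟩, hbm.2⟩
      rw [he] at this
      exact this
    · rintro ⟨hx, hxA, hxB⟩
      refine ⟨hx, hxA, Set.eq_empty_iff_forall_notMem.2 ?_⟩
      rintro z ⟨⟨hz, hzx⟩, hzB⟩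
      have h1 : z ∈ φ.atoms ∩ B := ⟨hz, hzB⟩
      have h2 : x ∈ φ.atoms ∩ B := ⟨hx, hxB⟩
      rw [hb] at h1 h2
      exact hzx (h1.trans h2.symm)
  · suffices h : {x ∈ φ.atoms | (x, φ.erase x) ∈ A ×ˢ voidEvent B} = ∅ by rw [h]; simp
    refine Set.eq_empty_iff_forall_notMem.2 ?_
    rintro x ⟨hx, -, he⟩
    simp only [voidEvent, Config.erase, Set.mem_ofPred_eq] at he
    have hsub : φ.atoms ∩ B ⊆ {x} := by
      intro z hz
      by_contra hzx
      have : z ∈ φ.atoms \ {x} ∩ B := ⟨⟨hz.1, hzx⟩, hz.2⟩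
      rw [he] at this
      exact this
    have := Set.ncard_le_ncard hsub
    rw [Set.ncard_singleton] at this
    change count B φ ≤ 1 at this
    omega

/-- The π-λ argument needs finite measures, whereas a configuration may have infinitely many atoms.
The first coordinate is therefore restricted to balls, and the restrictions increase to the full
measure. -/
theorem measurable_atomMeasure : Measurable atomMeasure := by
  have key : ∀ n : ℕ, Measurable fun φ : Config =>
      (atomMeasure φ).restrict (Metric.closedBall 0 (n : ℝ) ×ˢ Set.univ) := by
    intro n
    have hfin : ∀ φ : Config, IsFiniteMeasure
        ((atomMeasure φ).restrict (Metric.closedBall 0 (n : ℝ) ×ˢ Set.univ)) := by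
      intro φ
      refine ⟨?_⟩
      rw [Measure.restrict_apply_univ, atomMeasure_prod φ measurableSet_closedBall,
        encard_eq_count Metric.isBounded_closedBall]
      exact ENNReal.natCast_lt_top _
    have hrect : ∀ A B : Set Plane, MeasurableSet A → Bornology.IsBounded B → MeasurableSet B →
        Measurable fun φ : Config =>
          (atomMeasure φ).restrict (Metric.closedBall 0 (n : ℝ) ×ˢ Set.univ)
            (A ×ˢ voidEvent B) := by
      intro A B hA hB hBm
      have hA' : Bornology.IsBounded (A ∩ Metric.closedBall 0 (n : ℝ)) :=
        Metric.isBounded_closedBall.subset Set.inter_subset_right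
      have hAm' := hA.inter (measurableSet_closedBall (x := (0 : Plane)) (ε := (n : ℝ)))
      simp_rw [Measure.restrict_apply' ((measurableSet_closedBall (x := (0 : Plane))
        (ε := (n : ℝ))).prod (MeasurableSet.univ : MeasurableSet (Set.univ : Set Config))),
        Set.prod_inter_prod, Set.inter_univ, atomMeasure_prod_voidEvent _ hA' hAm' hB hBm]
      have h1 := measurable_count hB hBm
      refine Measurable.ite (h1 (measurableSet_singleton 0)) ?_
        (Measurable.ite (h1 (measurableSet_singleton 1)) ?_ measurable_const)
      · exact measurable_from_top.comp (measurable_count hA' hAm')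
      · exact measurable_from_top.comp (measurable_count (hA'.subset Set.inter_subset_left)
          (hAm'.inter hBm))
    refine Measurable.measure_of_isPiSystem
      (S := Set.image2 (· ×ˢ ·) {s | MeasurableSet s} boundedVoidEvents) ?_
      (MeasurableSpace.isPiSystem_measurableSet.prod isPiSystem_boundedVoidEvents) ?_ ?_
    · refine (generateFrom_eq_prod MeasurableSpace.generateFrom_measurableSet
        generateFrom_boundedVoidEvents.symm isCountablySpanning_measurableSet
        ⟨fun _ => Set.univ, fun _ => univ_mem_boundedVoidEvents, Set.iUnion_const _⟩).symm
    · rintro _ ⟨A, hA, _, ⟨B, hB, hBm, rfl⟩, rfl⟩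
      exact hrect A B hA hB hBm
    · have := hrect Set.univ ∅ MeasurableSet.univ Bornology.isBounded_empty MeasurableSet.empty
      simpa [voidEvent] using this
  refine Measure.measurable_of_measurable_coe _ fun s hs => ?_
  have h : ∀ φ : Config, atomMeasure φ s =
      ⨆ n : ℕ, (atomMeasure φ).restrict (Metric.closedBall 0 (n : ℝ) ×ˢ Set.univ) s := by
    intro φ
    simp_rw [Measure.restrict_apply hs]
    rw [← Monotone.measure_iUnion, ← Set.inter_iUnion, ← Set.iUnion_prod_const,
      Metric.iUnion_closedBall_nat, Set.univ_prod_univ, Set.inter_univ]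
    intro m n hmn
    exact Set.inter_subset_inter_right _ (Set.prod_mono
      (Metric.closedBall_subset_closedBall (by exact_mod_cast hmn)) subset_rfl)
  simp_rw [h]
  exact Measurable.iSup fun n => (Measure.measurable_coe hs).comp (key n)

/-! ### Joint measurability -/

/-- The number of atoms in a set that itself varies with a parameter. Pushing the atoms forward by
`Prod.mk p.1` turns the varying section into the fixed set `S`, so rectangles suffice again. -/
theorem measurable_atomMeasure_section {α : Type*} [MeasurableSpace α] {S : Set (α × Plane)}
    (hS : MeasurableSet S) :
    Measurable fun p : α × Config => atomMeasure p.2 ((Prod.mk p.1 ⁻¹' S) ×ˢ Set.univ) := by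
  have key : ∀ n : ℕ, Measurable fun p : α × Config =>
      ((((atomMeasure p.2).map Prod.fst).restrict (Metric.closedBall 0 (n : ℝ))).map
        (Prod.mk p.1)) := by
    intro n
    have hval : ∀ (p : α × Config) (s : Set (α × Plane)), MeasurableSet s →
        ((((atomMeasure p.2).map Prod.fst).restrict (Metric.closedBall 0 (n : ℝ))).map
        (Prod.mk p.1)) s = atomMeasure p.2
          ((Prod.mk p.1 ⁻¹' s ∩ Metric.closedBall 0 (n : ℝ)) ×ˢ Set.univ) := by
      intro p s hs
      have h1 := measurable_prodMk_left (x := p.1) hs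
      rw [Measure.map_apply measurable_prodMk_left hs, Measure.restrict_apply h1,
        Measure.map_apply measurable_fst (h1.inter measurableSet_closedBall), ← Set.prod_univ]
    have hfin : ∀ p : α × Config, IsFiniteMeasure
        ((((atomMeasure p.2).map Prod.fst).restrict (Metric.closedBall 0 (n : ℝ))).map
        (Prod.mk p.1)) := by
      intro p
      refine ⟨?_⟩
      rw [hval p _ MeasurableSet.univ, Set.preimage_univ, Set.univ_inter,
        atomMeasure_prod _ measurableSet_closedBall,
        encard_eq_count Metric.isBounded_closedBall]
      exact ENNReal.natCast_lt_top _
    have hrect : ∀ (A : Set α) (B : Set Plane), MeasurableSet A → MeasurableSet B →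
        Measurable fun p : α × Config =>
        ((((atomMeasure p.2).map Prod.fst).restrict (Metric.closedBall 0 (n : ℝ))).map
        (Prod.mk p.1)) (A ×ˢ B) := by
      intro A B hA hB
      simp_rw [fun p => hval p _ (hA.prod hB)]
      have : ∀ p : α × Config, atomMeasure p.2
          ((Prod.mk p.1 ⁻¹' (A ×ˢ B) ∩ Metric.closedBall 0 (n : ℝ)) ×ˢ Set.univ) =
          (Prod.fst ⁻¹' A).indicator (fun p : α × Config => atomMeasure p.2
          ((B ∩ Metric.closedBall 0 (n : ℝ)) ×ˢ Set.univ)) p := by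
        intro p
        by_cases hp : p.1 ∈ A
        · rw [Set.indicator_of_mem (by exact hp), Set.mk_preimage_prod_right hp]
        · rw [Set.indicator_of_notMem (by exact hp), Set.mk_preimage_prod_right_eq_empty hp]
          simp
      simp_rw [this]
      refine Measurable.indicator ?_ (measurable_fst hA)
      exact (Measure.measurable_coe ((hB.inter measurableSet_closedBall).prod
        MeasurableSet.univ)).comp (measurable_atomMeasure.comp measurable_snd)
    refine Measurable.measure_of_isPiSystem generateFrom_prod.symm isPiSystem_prod ?_ ?_
    · rintro _ ⟨A, hA, B, hB, rfl⟩
      exact hrect A B hA hB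
    · simpa using hrect Set.univ Set.univ MeasurableSet.univ MeasurableSet.univ
  have h : ∀ p : α × Config, atomMeasure p.2 ((Prod.mk p.1 ⁻¹' S) ×ˢ Set.univ) =
      ⨆ n : ℕ, ((((atomMeasure p.2).map Prod.fst).restrict (Metric.closedBall 0 (n : ℝ))).map
        (Prod.mk p.1)) S := by
    intro p
    have h1 := measurable_prodMk_left (x := p.1) hS
    simp_rw [Measure.map_apply measurable_prodMk_left hS, Measure.restrict_apply h1]
    rw [← Monotone.measure_iUnion, ← Set.inter_iUnion,
      Metric.iUnion_closedBall_nat, Set.inter_univ, Measure.map_apply measurable_fst h1,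
      ← Set.prod_univ]
    intro m n hmn
    exact Set.inter_subset_inter_right _
      (Metric.closedBall_subset_closedBall (by exact_mod_cast hmn))
  simp_rw [h]
  exact Measurable.iSup fun n => (Measure.measurable_coe hS).comp (key n)

theorem measurableSet_inter_section_eq_empty {α : Type*} [MeasurableSpace α]
    {S : Set (α × Plane)} (hS : MeasurableSet S) :
    MeasurableSet {p : α × Config | p.2.atoms ∩ Prod.mk p.1 ⁻¹' S = ∅} := by
  have : {p : α × Config | p.2.atoms ∩ Prod.mk p.1 ⁻¹' S = ∅} =
      (fun p : α × Config => atomMeasure p.2 ((Prod.mk p.1 ⁻¹' S) ×ˢ Set.univ)) ⁻¹' {0} := by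
    ext p
    rw [Set.mem_preimage, atomMeasure_prod _ (measurable_prodMk_left hS)]
    simp
  rw [this]
  exact measurable_atomMeasure_section hS (measurableSet_singleton 0)

theorem measurable_insert : Measurable fun p : Plane × Config => p.2.insert p.1 := by
  refine measurable_of_voidEvent fun B _ hBm => ?_
  have : {p : Plane × Config | (p.2.insert p.1).atoms ∩ B = ∅} =
      Prod.fst ⁻¹' Bᶜ ∩ {p | p.2.atoms ∩ Prod.mk p.1 ⁻¹' (Prod.snd ⁻¹' B) = ∅} := by
    ext p
    simp only [Config.insert, Set.mem_ofPred_eq, Set.mem_inter_iff, Set.mem_preimage,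
      Set.mem_compl_iff, Set.eq_empty_iff_forall_notMem, Set.mem_insert_iff]
    constructor
    · exact fun h => ⟨fun hp => h p.1 ⟨Or.inl rfl, hp⟩, fun z hz => h z ⟨Or.inr hz.1, hz.2⟩⟩
    · rintro ⟨h1, h2⟩ z ⟨rfl | hz, hzB⟩
      · exact h1 hzB
      · exact h2 z ⟨hz, hzB⟩
  rw [this]
  exact (measurable_fst hBm.compl).inter (measurableSet_inter_section_eq_empty (measurable_snd hBm))

theorem translate_atoms_inter_eq_empty_iff (x : Plane) (φ : Config) (B : Set Plane) :
    (translate x φ).atoms ∩ B = ∅ ↔ φ.atoms ∩ (fun z => z + x) ⁻¹' B = ∅ := by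
  change (fun z => z + x) '' φ.atoms ∩ B = ∅ ↔ _
  rw [← Set.image_inter_preimage, Set.image_eq_empty]

theorem measurable_translate_uncurry :
    Measurable fun p : Plane × Config => translate p.1 p.2 := by
  refine measurable_of_voidEvent fun B _ hBm => ?_
  simp_rw [translate_atoms_inter_eq_empty_iff]
  exact measurableSet_inter_section_eq_empty
    (S := (fun q : Plane × Plane => q.2 + q.1) ⁻¹' B) ((by fun_prop : Measurable _) hBm)

/-! ### The Mecke equation -/

theorem lintegral_poissonMeasure_natCast (r : ℝ≥0) :
    ∫⁻ n : ℕ, (n : ℝ≥0∞) ∂poissonMeasure r = r := by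
  rw [lintegral_countable']
  -- The term at `0` vanishes, and `(n + 1) p(n + 1) = r p(n)` reduces the rest to the total mass.
  rw [tsum_eq_zero_add' ENNReal.summable]
  have : ∀ n : ℕ, ((n + 1 : ℕ) : ℝ≥0∞) * poissonMeasure r {n + 1} = r * poissonMeasure r {n} := by
    intro n
    rw [poissonMeasure_singleton, poissonMeasure_singleton, ← ENNReal.ofReal_natCast,
      ← ENNReal.ofReal_coe_nnreal, ← ENNReal.ofReal_mul (by positivity),
      ← ENNReal.ofReal_mul (by positivity)]
    congr 1
    rw [Nat.factorial_succ]
    push_cast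
    field_simp
    ring
  simp_rw [this]
  have h2 := lintegral_countable' (μ := poissonMeasure r) (fun _ => 1)
  simp only [lintegral_const, one_mul, measure_univ] at h2
  rw [ENNReal.tsum_mul_left, ← h2]
  simp

variable {Ω : Type*} [MeasurableSpace Ω] {P : Measure Ω} {lam : ℝ≥0} {Φ : Ω → Config}

namespace IsPoissonProcess

theorem measurable_count_comp (h : IsPoissonProcess P lam Φ) {B : Set Plane}
    (hB : Bornology.IsBounded B) (hBm : MeasurableSet B) :
    Measurable fun ω => count B (Φ ω) := (measurable_count hB hBm).comp h.measurable

theorem measure_count_eq (h : IsPoissonProcess P lam Φ) {B : Set Plane}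
    (hB : Bornology.IsBounded B) (hBm : MeasurableSet B) (k : ℕ) :
    P {ω | count B (Φ ω) = k} = poissonMeasure (lam * (volume B).toNNReal) {k} :=
  (h.hasLaw_count B hB hBm).measure_eq (p := fun n => n = k) (measurableSet_singleton k)

theorem indepFun_count (h : IsPoissonProcess P lam Φ) {A B : Set Plane}
    (hA : Bornology.IsBounded A) (hAm : MeasurableSet A)
    (hB : Bornology.IsBounded B) (hBm : MeasurableSet B) (hd : Disjoint A B) :
    IndepFun (fun ω => count A (Φ ω)) (fun ω => count B (Φ ω)) P := by
  have := h.indep_count 2 ![A, B] (by simp [Fin.forall_fin_two, hA, hB])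
    (by simp [Fin.forall_fin_two, hAm, hBm])
    (by simp [Fin.forall_fin_two, hd, hd.symm])
  simpa using this.indepFun (i := 0) (j := 1) (by decide)

theorem map_voidEvent (h : IsPoissonProcess P lam Φ) {B : Set Plane}
    (hB : Bornology.IsBounded B) (hBm : MeasurableSet B) :
    P.map Φ (voidEvent B) = ENNReal.ofReal (Real.exp (-(lam * (volume B).toReal))) := by
  rw [voidEvent_eq_preimage hB, Measure.map_apply h.measurable
    (measurable_count hB hBm (measurableSet_singleton 0))]
  refine (h.measure_count_eq hB hBm 0).trans ?_
  rw [poissonMeasure_singleton]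
  simp [ENNReal.coe_toNNReal_eq_toReal]

theorem lintegral_count (h : IsPoissonProcess P lam Φ) {A : Set Plane}
    (hA : Bornology.IsBounded A) (hAm : MeasurableSet A) :
    ∫⁻ ω, (count A (Φ ω) : ℝ≥0∞) ∂P = lam * volume A := by
  have h1 := h.hasLaw_count A hA hAm
  have h2 := lintegral_map' (μ := P) (f := fun n : ℕ => (n : ℝ≥0∞)) measurable_from_top.aemeasurable
    h1.aemeasurable
  rw [h1.map_eq, lintegral_poissonMeasure_natCast] at h2
  rw [← h2, ENNReal.coe_mul, ENNReal.coe_toNNReal hA.measure_lt_top.ne]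

/-- When `B` is void the atoms of `A` are those of `A \ B`, whose number is independent of the
number in `B`. -/
theorem lintegral_count_of_void (h : IsPoissonProcess P lam Φ) {A B : Set Plane}
    (hA : Bornology.IsBounded A) (hAm : MeasurableSet A) (hB : Bornology.IsBounded B)
    (hBm : MeasurableSet B) :
    ∫⁻ ω, (if count B (Φ ω) = 0 then (count A (Φ ω) : ℝ≥0∞) else 0) ∂P =
      lam * volume (A \ B) * P.map Φ (voidEvent B) := by
  have hAB : Bornology.IsBounded (A \ B) := hA.subset Set.sdiff_subset
  have hABm := hAm.diff hBm
  have h1 : ∀ ω, (if count B (Φ ω) = 0 then (count A (Φ ω) : ℝ≥0∞) else 0) =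
      ((fun ω => (count (A \ B) (Φ ω) : ℝ≥0∞)) *
        fun ω => if count B (Φ ω) = 0 then (1 : ℝ≥0∞) else 0 : Ω → ℝ≥0∞) ω := by
    intro ω
    simp only [Pi.mul_apply]
    split_ifs with h0
    · rw [mul_one]
      rw [count_eq_zero_iff hB] at h0
      unfold count
      congr 2
      ext z
      simp only [Set.mem_inter_iff, Set.mem_sdiff]
      refine ⟨fun hz => ⟨hz.1, hz.2, fun hzB => ?_⟩, fun hz => ⟨hz.1, hz.2.1⟩⟩
      exact (Set.eq_empty_iff_forall_notMem.1 h0) z ⟨hz.1, hzB⟩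
    · simp
  simp_rw [h1]
  have hind := (h.indepFun_count hAB hABm hB hBm Set.disjoint_sdiff_left).comp
    (φ := fun n : ℕ => (n : ℝ≥0∞)) (ψ := fun n : ℕ => if n = 0 then (1 : ℝ≥0∞) else 0)
    measurable_from_top measurable_from_top
  refine (lintegral_mul_eq_lintegral_mul_lintegral_of_indepFun
    (measurable_from_top.comp (h.measurable_count_comp hAB hABm))
    ((measurable_from_top (f := fun n : ℕ => if n = 0 then (1 : ℝ≥0∞) else 0)).comp
      (h.measurable_count_comp hB hBm)) hind).trans ?_
  simp only [Function.comp_def]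
  rw [h.lintegral_count hAB hABm]
  congr 1
  have hs : MeasurableSet {ω | count B (Φ ω) = 0} :=
    h.measurable_count_comp hB hBm (measurableSet_singleton 0)
  rw [voidEvent_eq_preimage hB, Measure.map_apply h.measurable
    (measurable_count hB hBm (measurableSet_singleton 0))]
  have h2 := lintegral_indicator_one (μ := P) hs
  rw [← Set.preimage_comp]
  refine Eq.trans ?_ h2
  refine lintegral_congr fun ω => ?_
  simp [Set.indicator_apply]

/-- The integrand is the indicator of one atom in `A ∩ B` and none in `B \ A`. By independence its
mean is `λ|A ∩ B| exp(-λ|A ∩ B|) exp(-λ|B \ A|)`, and the exponentials combine to the void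
probability of `B`. -/
theorem lintegral_count_inter_of_count_eq_one (h : IsPoissonProcess P lam Φ) {A B : Set Plane}
    (hAm : MeasurableSet A) (hB : Bornology.IsBounded B) (hBm : MeasurableSet B) :
    ∫⁻ ω, (if count B (Φ ω) = 1 then (count (A ∩ B) (Φ ω) : ℝ≥0∞) else 0) ∂P =
      lam * volume (A ∩ B) * P.map Φ (voidEvent B) := by
  have h1b : Bornology.IsBounded (A ∩ B) := hB.subset Set.inter_subset_right
  have h2b : Bornology.IsBounded (B \ A) := hB.subset Set.sdiff_subset
  have h1m := hAm.inter hBm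
  have h2m := hBm.diff hAm
  have hadd : ∀ φ : Config, count B φ = count (A ∩ B) φ + count (B \ A) φ := by
    intro φ
    unfold count
    rw [← Set.ncard_union_eq _ (φ.finite_inter _ h1b) (φ.finite_inter _ h2b),
      ← Set.inter_union_distrib_left, Set.inter_comm A, Set.inter_union_sdiff]
    exact (Set.disjoint_sdiff_inter.symm.mono (by rw [Set.inter_comm A]; exact
      Set.inter_subset_right) Set.inter_subset_right)
  have hs : MeasurableSet ({ω | count (A ∩ B) (Φ ω) = 1} ∩ {ω | count (B \ A) (Φ ω) = 0}) :=
    (h.measurable_count_comp h1b h1m (measurableSet_singleton 1)).inter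
      (h.measurable_count_comp h2b h2m (measurableSet_singleton 0))
  have hind := (h.indepFun_count h1b h1m h2b h2m
    (Set.disjoint_sdiff_right.mono_left Set.inter_subset_left)).measure_inter_preimage_eq_mul
      {1} {0} (measurableSet_singleton _) (measurableSet_singleton _)
  have h2 := lintegral_indicator_one (μ := P) hs
  calc _ = ∫⁻ ω, ({ω | count (A ∩ B) (Φ ω) = 1} ∩ {ω | count (B \ A) (Φ ω) = 0}).indicator
        1 ω ∂P := by
        refine lintegral_congr fun ω => ?_
        simp only [hadd, Set.indicator_apply, Set.mem_inter_iff, Set.mem_ofPred_eq, Pi.one_apply]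
        by_cases h3 : count (A ∩ B) (Φ ω) = 1
        · by_cases h4 : count (B \ A) (Φ ω) = 0 <;> simp [h3, h4]
        · simp only [h3, false_and, if_false, ite_eq_right_iff, Nat.cast_eq_zero]
          intro h5
          omega
    _ = P {ω | count (A ∩ B) (Φ ω) = 1} * P {ω | count (B \ A) (Φ ω) = 0} := h2.trans hind
    _ = _ := by
        rw [h.measure_count_eq h1b h1m, h.measure_count_eq h2b h2m, h.map_voidEvent hB hBm,
          poissonMeasure_singleton, poissonMeasure_singleton,
          ← ENNReal.ofReal_mul (by positivity),
          show (lam : ℝ≥0∞) * volume (A ∩ B) = ENNReal.ofReal (lam * (volume (A ∩ B)).toReal) by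
            rw [ENNReal.ofReal_mul (by positivity), ENNReal.ofReal_coe_nnreal,
              ENNReal.ofReal_toReal h1b.measure_lt_top.ne],
          ← ENNReal.ofReal_mul (by positivity)]
        congr 1
        have hvol : (volume B).toReal = (volume (A ∩ B)).toReal + (volume (B \ A)).toReal := by
          rw [← ENNReal.toReal_add h1b.measure_lt_top.ne h2b.measure_lt_top.ne,
            Set.inter_comm A, measure_inter_add_sdiff B hAm]
        rw [hvol, mul_add, neg_add, Real.exp_add]
        simp [ENNReal.coe_toNNReal_eq_toReal]
        ring

theorem lintegral_atomMeasure_prod_voidEvent (h : IsPoissonProcess P lam Φ) {A B : Set Plane}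
    (hA : Bornology.IsBounded A) (hAm : MeasurableSet A) (hB : Bornology.IsBounded B)
    (hBm : MeasurableSet B) :
    ∫⁻ ω, atomMeasure (Φ ω) (A ×ˢ voidEvent B) ∂P = lam * volume A * P.map Φ (voidEvent B) := by
  have h1 : ∀ ω, atomMeasure (Φ ω) (A ×ˢ voidEvent B) =
      (if count B (Φ ω) = 0 then (count A (Φ ω) : ℝ≥0∞) else 0) +
      (if count B (Φ ω) = 1 then (count (A ∩ B) (Φ ω) : ℝ≥0∞) else 0) := by
    intro ω
    rw [atomMeasure_prod_voidEvent _ hA hAm hB hBm]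
    split_ifs with h0 h2 h2
    · omega
    · simp
    · simp
    · simp
  simp_rw [h1]
  rw [lintegral_add_left, h.lintegral_count_of_void hA hAm hB hBm,
    h.lintegral_count_inter_of_count_eq_one hAm hB hBm, ← add_mul, ← mul_add, add_comm,
    measure_inter_add_sdiff A hBm]
  exact Measurable.ite (h.measurable_count_comp hB hBm (measurableSet_singleton 0))
    (measurable_from_top.comp (h.measurable_count_comp hA hAm)) measurable_const

variable [IsProbabilityMeasure P]

/-- The Mecke equation, as an identity of measures. -/
theorem bind_atomMeasure (h : IsPoissonProcess P lam Φ) :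
    (P.map Φ).bind atomMeasure = ((lam : ℝ≥0∞) • (volume : Measure Plane)).prod (P.map Φ) := by
  have hprob : IsProbabilityMeasure (P.map Φ) :=
    Measure.isProbabilityMeasure_map h.measurable.aemeasurable
  symm
  refine Measure.prod_eq_generateFrom (C := {A | Bornology.IsBounded A ∧ MeasurableSet A})
    (D := boundedVoidEvents) ?_ generateFrom_boundedVoidEvents.symm ?_
    isPiSystem_boundedVoidEvents ?_ ?_ ?_
  · refine le_antisymm (MeasurableSpace.generateFrom_le fun s hs => hs.2) fun s hs => ?_
    have : s = ⋃ n : ℕ, s ∩ Metric.closedBall 0 n := by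
      rw [← Set.inter_iUnion, Metric.iUnion_closedBall_nat, Set.inter_univ]
    rw [this]
    exact MeasurableSet.iUnion fun n => MeasurableSpace.measurableSet_generateFrom
      ⟨Metric.isBounded_closedBall.subset Set.inter_subset_right,
        MeasurableSet.inter hs measurableSet_closedBall⟩
  · exact fun s hs t ht _ => ⟨hs.1.subset Set.inter_subset_left, hs.2.inter ht.2⟩
  · refine ⟨fun n => Metric.closedBall 0 n, fun n => ⟨Metric.isBounded_closedBall,
      measurableSet_closedBall⟩, fun n => ?_, Metric.iUnion_closedBall_nat 0⟩
    rw [Measure.smul_apply, smul_eq_mul]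
    exact ENNReal.mul_lt_top ENNReal.coe_lt_top measure_closedBall_lt_top
  · exact ⟨fun _ => Set.univ, fun _ => univ_mem_boundedVoidEvents, fun _ => measure_lt_top _ _,
      Set.iUnion_const _⟩
  · rintro A ⟨hA, hAm⟩ _ ⟨B, hB, hBm, rfl⟩
    have hV := measurableSet_voidEvent hB hBm
    rw [Measure.bind_apply (hAm.prod hV) measurable_atomMeasure.aemeasurable,
      lintegral_map (f := fun φ => atomMeasure φ (A ×ˢ voidEvent B))
        ((Measure.measurable_coe (hAm.prod hV)).comp measurable_atomMeasure) h.measurable,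
      Measure.smul_apply, smul_eq_mul]
    exact h.lintegral_atomMeasure_prod_voidEvent hA hAm hB hBm

/-- The law of a Poisson process is invariant under translations. -/
theorem map_translate (h : IsPoissonProcess P lam Φ) (x : Plane) :
    (P.map Φ).map (translate x) = P.map Φ := by
  have hprob : IsProbabilityMeasure (P.map Φ) :=
    Measure.isProbabilityMeasure_map h.measurable.aemeasurable
  have hprob' : IsProbabilityMeasure ((P.map Φ).map (translate x)) :=
    Measure.isProbabilityMeasure_map (measurable_translate x).aemeasurable
  refine ext_of_generate_finite _ generateFrom_boundedVoidEvents isPiSystem_boundedVoidEvents ?_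
    (by simp)
  rintro _ ⟨B, hB, hBm, rfl⟩
  have hV := measurableSet_voidEvent hB hBm
  have hpre : translate x ⁻¹' voidEvent B = voidEvent ((fun z => z + x) ⁻¹' B) := by
    ext φ
    exact translate_atoms_inter_eq_empty_iff x φ B
  have hB' : Bornology.IsBounded ((fun z => z + x) ⁻¹' B) :=
    (isometry_add_right x).antilipschitz.isBounded_preimage hB
  rw [Measure.map_apply (measurable_translate x) hV, hpre, h.map_voidEvent hB hBm,
    h.map_voidEvent hB' (measurable_add_const x hBm), measure_preimage_add_right]

end IsPoissonProcess

/-! ### Mutual nearest neighbours in terms of void regions -/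

/-- The region that contains no further atoms if `x` and `y` are mutual nearest neighbours. -/
def nnRegion (x y : Plane) : Set Plane :=
  Metric.closedBall x (dist x y) ∪ Metric.closedBall y (dist x y)

theorem isBounded_nnRegion (x y : Plane) : Bornology.IsBounded (nnRegion x y) :=
  Metric.isBounded_closedBall.union Metric.isBounded_closedBall

theorem measurableSet_nnRegion (x y : Plane) : MeasurableSet (nnRegion x y) :=
  measurableSet_closedBall.union measurableSet_closedBall

/-- The pairs of a point `y ≠ x` and a configuration without atoms, other than possibly `x`, in
the region spanned by `x` and `y`. -/
def mutualSet (x : Plane) : Set (Plane × Config) :=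
  {p | p.1 ≠ x ∧ p.2.atoms ∩ (nnRegion x p.1 \ {x}) = ∅}

theorem measurableSet_mutualSet (x : Plane) : MeasurableSet (mutualSet x) := by
  have hS : MeasurableSet {q : Plane × Plane | q.2 ∈ nnRegion x q.1 \ {x}} := by
    have : {q : Plane × Plane | q.2 ∈ nnRegion x q.1 \ {x}} =
        ({q | dist q.2 x ≤ dist x q.1} ∪ {q | dist q.2 q.1 ≤ dist x q.1}) \
          Prod.snd ⁻¹' {x} := by
      ext q
      simp [nnRegion]
    rw [this]
    exact ((measurableSet_le (by fun_prop) (by fun_prop)).union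
      (measurableSet_le (by fun_prop) (by fun_prop))).diff
        (measurable_snd (measurableSet_singleton x))
  exact (measurable_fst (measurableSet_singleton x).compl).inter
    (measurableSet_inter_section_eq_empty hS)

/-- Minimisers are strict, so the void discs are closed. The region omits `x` because `x`, unlike
`y`, is not erased from the configuration. -/
theorem mnnr_iff {φ : Config} {x y : Plane} :
    MNNR φ x y ↔ x ∈ φ.atoms ∧ y ∈ φ.atoms ∧ (y, φ.erase y) ∈ mutualSet x := by
  simp only [MNNR, NNR, mutualSet, Config.erase, nnRegion, Set.mem_ofPred_eq, Set.mem_sdiff,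
    Set.mem_singleton_iff, Set.eq_empty_iff_forall_notMem, Set.mem_inter_iff, Set.mem_union,
    Metric.mem_closedBall]
  constructor
  · rintro ⟨⟨⟨hy, hyx⟩, h1⟩, ⟨hx, -⟩, h2⟩
    refine ⟨hx, hy, hyx, ?_⟩
    rintro z ⟨⟨hz, hzy⟩, hd | hd, hzx⟩
    · have := h1 z ⟨hz, hzx⟩ hzy
      rw [dist_comm z] at hd
      linarith
    · have := h2 z ⟨hz, hzy⟩ hzx
      rw [dist_comm z, dist_comm x] at hd
      linarith
  · rintro ⟨hx, hy, hyx, h⟩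
    refine ⟨⟨⟨hy, hyx⟩, fun z hz hzy => ?_⟩, ⟨hx, Ne.symm hyx⟩, fun z hz hzx => ?_⟩
    · by_contra hd
      refine h z ⟨⟨hz.1, hzy⟩, Or.inl ?_, hz.2⟩
      rw [dist_comm z]
      exact not_lt.1 hd
    · by_contra hd
      refine h z ⟨⟨hz.1, hz.2⟩, Or.inr ?_, hzx⟩
      rw [dist_comm z, dist_comm x]
      exact not_lt.1 hd

theorem atomMeasure_mutualSet_ne_zero_iff {φ : Config} {x : Plane} :
    atomMeasure φ (mutualSet x) ≠ 0 ↔ ∃ y ∈ φ.atoms, (y, φ.erase y) ∈ mutualSet x := by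
  rw [atomMeasure_apply φ (measurableSet_mutualSet x)]
  simp only [ne_eq, ENat.toENNReal_eq_zero, Set.encard_eq_zero, ← Set.nonempty_iff_ne_empty]
  rfl

/-- Of two candidate partners, the one nearer to `x` would lie in the disc about `x` through the
other, which has to be void. -/
theorem atomMeasure_mutualSet_le_one (φ : Config) (x : Plane) :
    atomMeasure φ (mutualSet x) ≤ 1 := by
  rw [atomMeasure_apply φ (measurableSet_mutualSet x), ← ENat.toENNReal_one,
    ENat.toENNReal_le, Set.encard_le_one_iff]
  rintro y z ⟨hy, hyx, hye⟩ ⟨hz, hzx, hze⟩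
  by_contra hne
  rcases le_total (dist x z) (dist x y) with h | h
  · exact Set.eq_empty_iff_forall_notMem.1 hye z
      ⟨⟨hz, Ne.symm hne⟩, Or.inl (by rwa [Metric.mem_closedBall, dist_comm]), hzx⟩
  · exact Set.eq_empty_iff_forall_notMem.1 hze y
      ⟨⟨hy, hne⟩, Or.inl (by rwa [Metric.mem_closedBall, dist_comm]), hyx⟩

/-- The event that `x` has a mutual nearest neighbour. -/
def mutualEvent (x : Plane) : Set Config := {φ | ∃ y ∈ φ.atoms, MNNR φ x y}

theorem measurableSet_mem_atoms (x : Plane) : MeasurableSet {φ : Config | x ∈ φ.atoms} := by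
  have : {φ : Config | x ∈ φ.atoms} = (voidEvent {x})ᶜ := by
    ext φ
    simp [voidEvent]
  rw [this]
  exact (measurableSet_voidEvent Bornology.isBounded_singleton (measurableSet_singleton x)).compl

theorem measurableSet_mutualEvent (x : Plane) : MeasurableSet (mutualEvent x) := by
  have : mutualEvent x = {φ | x ∈ φ.atoms} ∩ {φ | atomMeasure φ (mutualSet x) ≠ 0} := by
    ext φ
    simp only [mutualEvent, mnnr_iff, Set.mem_inter_iff, Set.mem_ofPred_eq,
      atomMeasure_mutualSet_ne_zero_iff]
    exact ⟨fun ⟨y, hy, hx, _, h⟩ => ⟨hx, y, hy, h⟩, fun ⟨hx, y, hy, h⟩ => ⟨y, hy, hx, hy, h⟩⟩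
  rw [this]
  exact (measurableSet_mem_atoms x).inter
    ((Measure.measurable_coe (measurableSet_mutualSet x)).comp measurable_atomMeasure
      (measurableSet_singleton 0).compl)

/-- Membership in `mutualSet x` ignores the point `x`, so the right side does not depend on whether
`x` has been added. -/
theorem insert_mem_mutualEvent_iff {φ : Config} {x : Plane} :
    φ.insert x ∈ mutualEvent x ↔ atomMeasure φ (mutualSet x) ≠ 0 := by
  rw [atomMeasure_mutualSet_ne_zero_iff]
  simp only [mutualEvent, mnnr_iff, Set.mem_ofPred_eq, mutualSet, Config.insert, Config.erase,
    Set.eq_empty_iff_forall_notMem, Set.mem_inter_iff, Set.mem_insert_iff, Set.mem_sdiff,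
    Set.mem_singleton_iff]
  grind

theorem isSingle_eq (x : Plane) :
    {φ | IsSingle φ x} = {φ | x ∈ φ.atoms} \ mutualEvent x := by
  ext φ
  simp only [IsSingle, mutualEvent, MNNR, Set.mem_sdiff, Set.mem_ofPred_eq]
  refine and_congr_right fun _ => ?_
  constructor
  · rintro h ⟨y, -, h1, h2⟩
    exact h y h1.1 h1 h2
  · exact fun h y hy h1 h2 => h ⟨y, hy.1, h1, h2⟩

/-! ### The Palm distribution of the Poisson process -/

theorem measurable_insert_left (x : Plane) : Measurable (Config.insert x) :=
  measurable_insert.comp measurable_prodMk_left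

/-- Campbell's formula on a disc, whose area is positive and finite, can be solved for the Palm
probability. -/
theorem IsPalm.eq {P₀ P₁ : Measure Config} (hlam : 0 < lam) (h₀ : IsPalm P lam Φ P₀)
    (h₁ : IsPalm P lam Φ P₁) : P₀ = P₁ := by
  ext Γ hΓ
  have h := (h₀.campbell (Metric.closedBall 0 1) Γ measurableSet_closedBall hΓ).symm.trans
    (h₁.campbell (Metric.closedBall 0 1) Γ measurableSet_closedBall hΓ)
  refine (ENNReal.mul_right_inj ?_ ?_).1 h
  · refine mul_ne_zero (by exact_mod_cast hlam.ne') (Metric.measure_closedBall_pos _ _ ?_).ne'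
    exact one_pos
  · exact ENNReal.mul_ne_top ENNReal.coe_ne_top measure_closedBall_lt_top.ne

namespace IsPoissonProcess

variable [IsProbabilityMeasure P]

theorem lintegral_atomMeasure (h : IsPoissonProcess P lam Φ) {S : Set (Plane × Config)}
    (hS : MeasurableSet S) :
    ∫⁻ φ, atomMeasure φ S ∂P.map Φ = lam * ∫⁻ x, P.map Φ (Prod.mk x ⁻¹' S) := by
  have hprob : IsProbabilityMeasure (P.map Φ) :=
    Measure.isProbabilityMeasure_map h.measurable.aemeasurable
  rw [← Measure.bind_apply hS measurable_atomMeasure.aemeasurable, h.bind_atomMeasure,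
    Measure.prod_apply hS, lintegral_smul_measure, smul_eq_mul]

/-- Slivnyak's theorem: the Palm distribution of a Poisson process is the law of the process with
an atom added at the origin. -/
theorem isPalm_map_insert (h : IsPoissonProcess P lam Φ) :
    IsPalm P lam Φ ((P.map Φ).map (Config.insert 0)) := by
  have hprob : IsProbabilityMeasure (P.map Φ) :=
    Measure.isProbabilityMeasure_map h.measurable.aemeasurable
  refine ⟨Measure.isProbabilityMeasure_map (measurable_insert_left 0).aemeasurable, ?_⟩
  intro A Γ hA hΓ
  -- `atomMeasure` erases the atom `x`; inserting it again recovers `φ`, so the Campbell sum becomes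
  -- the mass of `S`.
  let S : Set (Plane × Config) := {p | p.1 ∈ A ∧ translate (-p.1) (p.2.insert p.1) ∈ Γ}
  have hS : MeasurableSet S := by
    refine (measurable_fst hA).inter ?_
    exact (measurable_translate_uncurry.comp (measurable_fst.neg.prodMk measurable_insert)) hΓ
  have h1 : ∀ φ : Config, ∑' x : φ.atoms, A.indicator (fun _ => (1 : ℝ≥0∞)) (x : Plane) *
      Γ.indicator (fun _ => (1 : ℝ≥0∞)) (translate (-(x : Plane)) φ) = atomMeasure φ S := by
    intro φ
    rw [atomMeasure, Measure.sum_apply _ hS]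
    refine tsum_congr fun x => ?_
    rw [Measure.dirac_apply' _ hS]
    by_cases hx : (x : Plane) ∈ A <;> by_cases hxΓ : translate (-(x : Plane)) φ ∈ Γ <;>
      simp [S, Config.insert_erase x.2, hx, hxΓ]
  simp_rw [h1]
  rw [← lintegral_map (f := fun φ => atomMeasure φ S)
    ((Measure.measurable_coe hS).comp measurable_atomMeasure) h.measurable,
    h.lintegral_atomMeasure hS, mul_assoc]
  congr 1
  have h2 : ∀ x : Plane, P.map Φ (Prod.mk x ⁻¹' S) =
      A.indicator (fun _ => (P.map Φ).map (Config.insert 0) Γ) x := by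
    intro x
    by_cases hx : x ∈ A
    · have : Prod.mk x ⁻¹' S = translate (-x) ⁻¹' (Config.insert 0 ⁻¹' Γ) := by
        ext φ
        simp [S, hx, translate_insert]
      rw [Set.indicator_of_mem hx, this, Measure.map_apply (measurable_insert_left 0) hΓ,
        ← Measure.map_apply (measurable_translate _) (measurable_insert_left 0 hΓ),
        h.map_translate]
    · have : Prod.mk x ⁻¹' S = ∅ := by
        ext φ
        simp [S, hx]
      rw [Set.indicator_of_notMem hx, this, measure_empty]
  simp_rw [h2]
  rw [lintegral_indicator hA, setLIntegral_const, mul_comm]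

theorem palmAt_eq (h : IsPoissonProcess P lam Φ) (x : Plane) :
    palmAt ((P.map Φ).map (Config.insert 0)) x = (P.map Φ).map (Config.insert x) := by
  rw [palmAt, Measure.map_map (measurable_translate x) (measurable_insert_left 0)]
  have : translate x ∘ Config.insert 0 = Config.insert x ∘ translate x := by
    ext1 φ
    simp [translate_insert]
  rw [this, ← Measure.map_map (measurable_insert_left x) (measurable_translate x),
    h.map_translate]

theorem map_insert_mutualEvent (h : IsPoissonProcess P lam Φ) (x : Plane) :
    (P.map Φ).map (Config.insert x) (mutualEvent x) =
      lam * ∫⁻ y, ENNReal.ofReal (Real.exp (-(lam * (volume (nnRegion x y)).toReal))) := by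
  have hm : MeasurableSet {φ | atomMeasure φ (mutualSet x) ≠ 0} :=
    (Measure.measurable_coe (measurableSet_mutualSet x)).comp measurable_atomMeasure
      (measurableSet_singleton 0).compl
  have h1 : Config.insert x ⁻¹' mutualEvent x = {φ | atomMeasure φ (mutualSet x) ≠ 0} := by
    ext φ
    exact insert_mem_mutualEvent_iff
  rw [Measure.map_apply (measurable_insert_left x) (measurableSet_mutualEvent x), h1,
    ← lintegral_indicator_one hm]
  -- The number of partners is 0 or 1, so it equals the indicator of being nonzero.
  have h2 : ∀ φ : Config, {φ | atomMeasure φ (mutualSet x) ≠ 0}.indicator 1 φ =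
      atomMeasure φ (mutualSet x) := by
    intro φ
    by_cases hφ : atomMeasure φ (mutualSet x) = 0
    · simp [hφ]
    · rw [Set.indicator_of_mem (by exact hφ)]
      refine le_antisymm ?_ (atomMeasure_mutualSet_le_one φ x)
      rw [atomMeasure_apply φ (measurableSet_mutualSet x)] at hφ ⊢
      rw [Pi.one_apply, ← ENat.toENNReal_one, ENat.toENNReal_le, Order.one_le_iff_ne_zero]
      simpa using hφ
  simp_rw [h2]
  rw [h.lintegral_atomMeasure (measurableSet_mutualSet x)]
  congr 1
  refine lintegral_congr_ae ?_
  -- The point `y = x`, where `mutualSet x` has empty section, is null; so is the point `x` removed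
  -- from the region.
  filter_upwards [compl_mem_ae_iff.2 (measure_singleton x)] with y hy
  have h3 : Prod.mk y ⁻¹' mutualSet x = voidEvent (nnRegion x y \ {x}) := by
    ext φ
    simp only [mutualSet, voidEvent, Set.mem_preimage, Set.mem_ofPred_eq]
    exact and_iff_right hy
  rw [h3, h.map_voidEvent ((isBounded_nnRegion x y).subset Set.sdiff_subset)
    ((measurableSet_nnRegion x y).diff (measurableSet_singleton x)),
    measure_sdiff_null (measure_singleton x)]

end IsPoissonProcess

/-! ### The area of the union of two discs through each other's centres -/

theorem integral_sqrt_one_sub_sq_neg_one_half :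
    ∫ a in (-1 : ℝ)..(1 / 2), √(1 - a ^ 2) = √3 / 8 + Real.pi / 3 := by
  have hderiv : ∀ a ∈ Set.Ioo (-1 : ℝ) (1 / 2),
      HasDerivAt (fun a => (a * √(1 - a ^ 2) + Real.arcsin a) / 2) (√(1 - a ^ 2)) a := by
    intro a ha
    have hpos : 0 < 1 - a ^ 2 := by nlinarith [ha.1, ha.2]
    have hs : 0 < √(1 - a ^ 2) := Real.sqrt_pos.2 hpos
    have h1 : HasDerivAt (fun a : ℝ => 1 - a ^ 2) (-(2 * a)) a := by
      simpa using (hasDerivAt_pow 2 a).const_sub 1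
    have h2 := (((hasDerivAt_id a).mul (h1.sqrt hpos.ne')).add
      (Real.hasDerivAt_arcsin ha.1.ne' (by linarith [ha.2]))).div_const 2
    refine h2.congr_deriv ?_
    simp only [id_eq]
    field_simp
    rw [Real.sq_sqrt hpos.le]
    ring
  rw [intervalIntegral.integral_eq_sub_of_hasDerivAt_of_le (by norm_num)
    (by fun_prop) hderiv ((by fun_prop : Continuous _).intervalIntegrable _ _)]
  have h3 : √(1 - (1 / 2 : ℝ) ^ 2) = √3 / 2 := by
    rw [show (1 - (1 / 2 : ℝ) ^ 2) = 3 / 2 ^ 2 by norm_num, Real.sqrt_div (by norm_num),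
      Real.sqrt_sq (by norm_num)]
  have h4 : Real.arcsin (1 / 2) = Real.pi / 6 := by
    rw [← Real.sin_pi_div_six, Real.arcsin_sin] <;> linarith [Real.pi_pos]
  rw [h3, h4, Real.arcsin_neg_one]
  norm_num
  ring

/-- The integrand is the length of the vertical slice at abscissa `a` through the unit discs centred
at `(0, 0)` and `(1, 0)`. The union spans `-1 ≤ a ≤ 2`; left of `a = 1/2` the first disc has the
longer slice, and reflection in that line gives the other half. -/
theorem integral_sqrt_one_sub_min_sq :
    ∫ a, 2 * √(1 - min (a ^ 2) ((a - 1) ^ 2)) = 4 * Real.pi / 3 + √3 / 2 := by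
  have hsupp : ∀ a : ℝ, a ∉ Set.Ioc (-1 : ℝ) 2 → 2 * √(1 - min (a ^ 2) ((a - 1) ^ 2)) = 0 := by
    intro a ha
    rw [Real.sqrt_eq_zero_of_nonpos, mul_zero]
    rw [Set.mem_Ioc, not_and_or, not_lt, not_le] at ha
    rw [sub_nonpos]
    refine le_min ?_ ?_ <;> rcases ha with ha | ha <;> nlinarith
  have hc : Continuous fun a : ℝ => 2 * √(1 - min (a ^ 2) ((a - 1) ^ 2)) := by fun_prop
  rw [← setIntegral_eq_integral_of_forall_compl_eq_zero (s := Set.Ioc (-1 : ℝ) 2) hsupp,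
    ← intervalIntegral.integral_of_le (by norm_num),
    ← intervalIntegral.integral_add_adjacent_intervals (b := 1 / 2)
      (hc.intervalIntegrable _ _) (hc.intervalIntegrable _ _)]
  have h1 : ∫ a in (-1 : ℝ)..(1 / 2), 2 * √(1 - min (a ^ 2) ((a - 1) ^ 2)) =
      2 * (√3 / 8 + Real.pi / 3) := by
    rw [← integral_sqrt_one_sub_sq_neg_one_half, ← intervalIntegral.integral_const_mul]
    refine intervalIntegral.integral_congr fun a ha => ?_
    rw [Set.uIcc_of_le (by norm_num)] at ha
    rw [min_eq_left (by nlinarith [ha.2])]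
  have h2 : ∫ a in (1 / 2 : ℝ)..2, 2 * √(1 - min (a ^ 2) ((a - 1) ^ 2)) =
      2 * (√3 / 8 + Real.pi / 3) := by
    rw [← h1]
    have := intervalIntegral.integral_comp_sub_left (a := -1) (b := 1 / 2)
      (fun a : ℝ => 2 * √(1 - min (a ^ 2) ((a - 1) ^ 2))) 1
    norm_num at this
    norm_num
    rw [← this]
    refine intervalIntegral.integral_congr fun a _ => ?_
    rw [min_comm, show (1 - a) ^ 2 = (a - 1) ^ 2 by ring]
  rw [h1, h2]
  ring

/-- When `1 - min s t` is negative the slice is empty, in agreement with the value `0` of `√` there.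
-/
theorem volume_sq_le_or (s t : ℝ) :
    volume {b : ℝ | s + b ^ 2 ≤ 1 ∨ t + b ^ 2 ≤ 1} = ENNReal.ofReal (2 * √(1 - min s t)) := by
  by_cases h : 0 ≤ 1 - min s t
  · have : {b : ℝ | s + b ^ 2 ≤ 1 ∨ t + b ^ 2 ≤ 1} = Set.Icc (-√(1 - min s t)) √(1 - min s t) := by
      ext b
      rw [Set.mem_Icc, ← abs_le, Set.mem_ofPred_eq, ← Real.sqrt_sq_eq_abs, Real.sqrt_le_sqrt_iff h,
        le_sub_comm, min_le_iff, le_sub_iff_add_le, le_sub_iff_add_le]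
    rw [this, Real.volume_Icc]
    ring_nf
  · have : {b : ℝ | s + b ^ 2 ≤ 1 ∨ t + b ^ 2 ≤ 1} = ∅ := by
      ext b
      rw [not_le, sub_neg, lt_min_iff] at h
      simp only [Set.mem_ofPred_eq, Set.mem_empty_iff_false, iff_false, not_or, not_le]
      constructor <;> nlinarith [h.1, h.2, sq_nonneg b]
    rw [this, Real.sqrt_eq_zero_of_nonpos (not_le.1 h).le]
    simp

theorem measurableSet_two_discs :
    MeasurableSet {p : ℝ × ℝ | p.1 ^ 2 + p.2 ^ 2 ≤ 1 ∨ (p.1 - 1) ^ 2 + p.2 ^ 2 ≤ 1} := by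
  have h1 : MeasurableSet {p : ℝ × ℝ | p.1 ^ 2 + p.2 ^ 2 ≤ 1} :=
    measurableSet_le (by fun_prop) (by fun_prop)
  have h2 : MeasurableSet {p : ℝ × ℝ | (p.1 - 1) ^ 2 + p.2 ^ 2 ≤ 1} :=
    measurableSet_le (by fun_prop) (by fun_prop)
  exact h1.union h2

theorem volume_prod_two_discs :
    volume {p : ℝ × ℝ | p.1 ^ 2 + p.2 ^ 2 ≤ 1 ∨ (p.1 - 1) ^ 2 + p.2 ^ 2 ≤ 1} =
      ENNReal.ofReal (4 * Real.pi / 3 + √3 / 2) := by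
  have hint : ∀ a : ℝ, 0 ≤ 2 * √(1 - min (a ^ 2) ((a - 1) ^ 2)) := fun a => by positivity
  rw [Measure.volume_eq_prod, Measure.prod_apply measurableSet_two_discs,
    ← integral_sqrt_one_sub_min_sq,
    ofReal_integral_eq_lintegral_ofReal _ (Filter.Eventually.of_forall hint)]
  · refine lintegral_congr fun a => ?_
    rw [← volume_sq_le_or]
    rfl
  -- A non-integrable function would have Bochner integral `0`, but the computed value is positive.
  · by_contra hni
    have := integral_sqrt_one_sub_min_sq
    rw [integral_undef hni] at this
    have : 0 < 4 * Real.pi / 3 + √3 / 2 := by positivity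
    linarith

/-- Multiplication by the complex number with coordinates `w`, as a linear map of the plane. -/
noncomputable def rotScale (w : Plane) : Plane →ₗ[ℝ] Plane :=
  Matrix.toLpLin 2 2 !![w 0, -w 1; w 1, w 0]

theorem rotScale_apply_zero (w v : Plane) : rotScale w v 0 = w 0 * v 0 - w 1 * v 1 := by
  simp [rotScale, Matrix.mulVec, dotProduct, Fin.sum_univ_two]
  ring

theorem rotScale_apply_one (w v : Plane) : rotScale w v 1 = w 1 * v 0 + w 0 * v 1 := by
  simp [rotScale, Matrix.mulVec, dotProduct, Fin.sum_univ_two]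

theorem norm_sq_eq (v : Plane) : ‖v‖ ^ 2 = v 0 ^ 2 + v 1 ^ 2 := by
  simp [EuclideanSpace.norm_sq_eq, Fin.sum_univ_two]

theorem norm_rotScale (w v : Plane) : ‖rotScale w v‖ = ‖w‖ * ‖v‖ := by
  rw [← sq_eq_sq₀ (norm_nonneg _) (by positivity), mul_pow, norm_sq_eq, norm_sq_eq, norm_sq_eq,
    rotScale_apply_zero, rotScale_apply_one]
  ring

theorem det_rotScale (w : Plane) : LinearMap.det (rotScale w) = ‖w‖ ^ 2 := by
  rw [norm_sq_eq, rotScale, Matrix.toLpLin_eq_toLin, LinearMap.det_toLin, Matrix.det_fin_two_of]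
  ring

theorem volume_nnRegion_zero_single :
    volume (nnRegion 0 (EuclideanSpace.single (0 : Fin 2) (1 : ℝ))) =
      ENNReal.ofReal (4 * Real.pi / 3 + √3 / 2) := by
  have h1 := (EuclideanSpace.volume_preserving_symm_measurableEquiv_toLp (Fin 2))
  have h2 := (volume_preserving_finTwoArrow ℝ).comp h1
  rw [← volume_prod_two_discs, ← h2.measure_preimage]
  · congr 1
    ext v
    simp only [nnRegion, Set.mem_union, Metric.mem_closedBall, dist_eq_norm, zero_sub, norm_neg,
      sub_zero, PiLp.norm_single, norm_one]
    rw [← sq_le_one_iff₀ (norm_nonneg _), ← sq_le_one_iff₀ (norm_nonneg _), norm_sq_eq, norm_sq_eq]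
    simp
  · exact measurableSet_two_discs.nullMeasurableSet

/-- After translating `x` to the origin, `rotScale (y - x)` is a similarity of ratio `‖y - x‖`
taking the first basis vector to `y - x`. It maps the standard pair of unit discs onto the region
and multiplies area by its determinant `‖y - x‖ ^ 2`. -/
theorem volume_nnRegion (x y : Plane) :
    (volume (nnRegion x y)).toReal = (4 * Real.pi / 3 + √3 / 2) * ‖y - x‖ ^ 2 := by
  rcases eq_or_ne y x with rfl | hne
  · simp [nnRegion]
  have hw : 0 < ‖y - x‖ := norm_pos_iff.2 (sub_ne_zero.2 hne)
  have h1 : volume (nnRegion x y) = volume (nnRegion 0 (y - x)) := by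
    rw [← measure_preimage_add_right volume x (nnRegion x y)]
    congr 1
    ext v
    simp [nnRegion, dist_eq_norm, norm_sub_rev x y, sub_sub_eq_add_sub]
  have h2 : rotScale (y - x) ⁻¹' nnRegion 0 (y - x) =
      nnRegion 0 (EuclideanSpace.single (0 : Fin 2) (1 : ℝ)) := by
    have h3 : rotScale (y - x) (EuclideanSpace.single (0 : Fin 2) (1 : ℝ)) = y - x := by
      ext i
      fin_cases i
      · simpa using rotScale_apply_zero (y - x) (EuclideanSpace.single (0 : Fin 2) (1 : ℝ))
      · simpa using rotScale_apply_one (y - x) (EuclideanSpace.single (0 : Fin 2) (1 : ℝ))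
    ext v
    simp only [nnRegion, Set.mem_preimage, Set.mem_union, Metric.mem_closedBall, dist_eq_norm,
      zero_sub, norm_neg, sub_zero, PiLp.norm_single, norm_one]
    conv_lhs => rw [show rotScale (y - x) v - (y - x) =
      rotScale (y - x) (v - EuclideanSpace.single (0 : Fin 2) (1 : ℝ)) by rw [map_sub, h3]]
    rw [norm_rotScale, norm_rotScale, mul_le_iff_le_one_right hw, mul_le_iff_le_one_right hw]
  have h4 := Measure.addHaar_preimage_linearMap (volume : Measure Plane)
    (f := rotScale (y - x)) (by rw [det_rotScale]; positivity) (nnRegion 0 (y - x))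
  rw [h2, volume_nnRegion_zero_single, det_rotScale, ← h1] at h4
  have h5 := congrArg ENNReal.toReal h4
  rw [ENNReal.toReal_mul, ENNReal.toReal_ofReal (by positivity),
    ENNReal.toReal_ofReal (by positivity), abs_of_pos (by positivity)] at h5
  rw [h5]
  field_simp

/-- In dimension two the Gaussian integral with rate `λc` is `π / (λc)`, so the prefactor `λ`
cancels: this is why the answer does not depend on the intensity. -/
theorem lintegral_exp_neg_nnRegion {lam : ℝ≥0} (hlam : 0 < lam) (x : Plane) :
    lam * ∫⁻ y, ENNReal.ofReal (Real.exp (-(lam * (volume (nnRegion x y)).toReal))) =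
      ENNReal.ofReal (1 / (2 - nnGamma)) := by
  have hl : (0 : ℝ) < lam := hlam
  set c : ℝ := 4 * Real.pi / 3 + √3 / 2 with hc
  have hcpos : 0 < c := by positivity
  have hg := GaussianFourier.integral_rexp_neg_mul_sq_norm (V := Plane) (b := lam * c)
    (by positivity)
  rw [finrank_euclideanSpace_fin] at hg
  norm_num at hg
  have h1 : ∫⁻ y, ENNReal.ofReal (Real.exp (-(lam * (volume (nnRegion x y)).toReal))) =
      ENNReal.ofReal (Real.pi / (lam * c)) := by
    simp_rw [volume_nnRegion, ← hc]
    rw [lintegral_sub_right_eq_self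
      (fun y : Plane => ENNReal.ofReal (Real.exp (-(lam * (c * ‖y‖ ^ 2))))) x, ← hg,
      ofReal_integral_eq_lintegral_ofReal]
    · refine lintegral_congr fun y => ?_
      ring_nf
    · by_contra hni
      rw [integral_undef hni] at hg
      have : 0 < Real.pi / (lam * c) := by positivity
      linarith
    · exact Filter.Eventually.of_forall fun y => (Real.exp_pos _).le
  rw [h1, ← ENNReal.ofReal_coe_nnreal, ← ENNReal.ofReal_mul hl.le]
  congr 1
  have h2 : c = Real.pi * (2 - nnGamma) := by
    rw [hc, nnGamma]
    have := Real.pi_pos.ne'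
    field_simp
    ring
  have h3 : 2 - nnGamma ≠ 0 := fun h => by rw [h, mul_zero] at h2; exact hcpos.ne' h2
  rw [h2]
  have := Real.pi_pos.ne'
  field_simp

theorem abs_inv_two_sub_nnGamma_sub_lt : |1 / (2 - nnGamma) - 0.6215| < 0.00005 := by
  have h1 := Real.pi_gt_d6
  have h2 := Real.pi_lt_d6
  have h3 : 1.73205 < √3 := Real.lt_sqrt_of_sq_lt (by norm_num)
  have h4 : √3 < 1.73206 := (Real.sqrt_lt' (by norm_num)).2 (by norm_num)
  have h5 : 0.27566 < √3 / (2 * Real.pi) := by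
    rw [lt_div_iff₀ (by positivity)]
    linarith
  have h6 : √3 / (2 * Real.pi) < 0.27567 := by
    rw [div_lt_iff₀ (by positivity)]
    linarith
  have h7 : 0 < 2 - nnGamma := by unfold nnGamma; linarith
  rw [abs_lt, lt_sub_iff_add_lt, sub_lt_iff_lt_add, lt_div_iff₀ h7, div_lt_iff₀ h7]
  unfold nnGamma
  constructor <;> linarith

end PlanarPP

theorem theorem1 :
    ∃ pstar : ℝ, pstar = 1 / (2 - PlanarPP.nnGamma) ∧ |pstar - 0.6215| < 0.00005 ∧
      ∀ (lam : ℝ≥0), 0 < lam →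
      ∀ (Ω : Type*) [MeasurableSpace Ω] (P : Measure Ω) [IsProbabilityMeasure P]
        (Φ : Ω → PlanarPP.Config), PlanarPP.IsPoissonProcess P lam Φ →
        (∃! P₀ : Measure PlanarPP.Config, PlanarPP.IsPalm P lam Φ P₀) ∧
        ∀ P₀ : Measure PlanarPP.Config, PlanarPP.IsPalm P lam Φ P₀ → ∀ x : PlanarPP.Plane,
          PlanarPP.palmAt P₀ x {φ | ∃ y ∈ φ.atoms, PlanarPP.MNNR φ x y} = ENNReal.ofReal pstar ∧
          PlanarPP.palmAt P₀ x {φ | PlanarPP.IsSingle φ x} = ENNReal.ofReal (1 - pstar) := by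
  refine ⟨_, rfl, PlanarPP.abs_inv_two_sub_nnGamma_sub_lt, ?_⟩
  intro lam hlam Ω _ P _ Φ h
  have hpalm := h.isPalm_map_insert
  refine ⟨⟨_, hpalm, fun P₁ h₁ => h₁.eq hlam hpalm⟩, fun P₀ h₀ x => ?_⟩
  have hprob : IsProbabilityMeasure (P.map Φ) :=
    Measure.isProbabilityMeasure_map h.measurable.aemeasurable
  have hprob' : IsProbabilityMeasure ((P.map Φ).map (PlanarPP.Config.insert x)) :=
    Measure.isProbabilityMeasure_map (PlanarPP.measurable_insert_left x).aemeasurable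
  rw [h₀.eq hlam hpalm, h.palmAt_eq]
  have h1 : (P.map Φ).map (PlanarPP.Config.insert x) (PlanarPP.mutualEvent x) =
      ENNReal.ofReal (1 / (2 - PlanarPP.nnGamma)) := by
    rw [h.map_insert_mutualEvent, PlanarPP.lintegral_exp_neg_nnRegion hlam]
  refine ⟨h1, ?_⟩
  -- Under the Palm law at `x` the point `x` is surely an atom, so being single is complementary to
  -- having a partner.
  have h2 : (P.map Φ).map (PlanarPP.Config.insert x) {φ | x ∈ φ.atoms} = 1 := by
    rw [Measure.map_apply (PlanarPP.measurable_insert_left x) (PlanarPP.measurableSet_mem_atoms x)]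
    refine (congrArg _ (Set.eq_univ_of_forall fun φ => ?_)).trans measure_univ
    exact Set.mem_insert x φ.atoms
  have hsub : PlanarPP.mutualEvent x ⊆ {φ | x ∈ φ.atoms} := by
    rintro φ ⟨y, _, hy⟩
    exact (PlanarPP.mnnr_iff.1 hy).1
  rw [PlanarPP.isSingle_eq, measure_sdiff hsub
    (PlanarPP.measurableSet_mutualEvent x).nullMeasurableSet (measure_ne_top _ _), h1, h2,
    ENNReal.ofReal_sub, ENNReal.ofReal_one]
  -- `ENNReal.ofReal_sub` needs the subtracted number to be nonnegative; the numerical bound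
  -- provides this.
  have := abs_lt.1 PlanarPP.abs_inv_two_sub_nnGamma_sub_lt
  linarith [this.1]
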